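/- **Setting.** For a 1-current $T$ in $\mathbb{R}^2$ and a scale $\lambda>0$ let $$\mathbb{F}_\lambda(T)=\inf_{S}\big\{|T-\partial S|+\lambda\,\mathcal{A}(S)\big\},$$ where $S$ runs over the integral 2-currents in $\mathbb{R}^2$, $|\cdot|$ is the mass (length with multiplicity) of a 1-current and $\mathcal{A}(S)$ is the mass (area with multiplicity) of $S$. A PWL current with nodes $v_0,\dots,v_n$ is the sum of the oriented segments $e_j=(v_{j-1},v_j)$; it lies in $\mathcal{L}_n[s,t;\mathbb{R}^2]$ if $v_0=s$, $v_n=t$, the nodes are distinct, consecutive edges meet only in their common node and other edges are disjoint. A *positive $\delta$-perturbation* of the node $v_i$ of a PWL current $T$ replaces $v_i$ by a point $\tilde v_i$ with $\|\tilde v_i-v_i\|<\delta$ such that $\det[\tilde v_i-v_i,e]^{\mathsf T}>0$ (where $\det[x,y]^{\mathsf T}=x_1y_2-x_2y_1$) for each edge $e$ of $T$ incident to $v_i$ (two edges for an interior node, one for $v_0$ and $v_n$), and such that each new edge joining $\tilde v_i$ to a neighbour of $v_i$ meets $T$ only in that neighbour. The *region* $S_i$ swept by it is the sum of the oriented triangles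 spanned by $\tilde v_i$ and the edges incident to $v_i$; for an interior node it is the quadrilateral whose boundary is the new current minus the old one, for $i\in\{0,n\}$ it is one triangle. Let $n\ge 2$, $T_0\in\mathcal{L}_n[s,t;\mathbb{R}^2]$ and $T_1=T_0$. For $0\le k_0<k\le n$ consider sequences $$T_1=\widetilde T_1^{\,k_0-1}\rightsquigarrow\widetilde T_1^{\,k_0}\rightsquigarrow\cdots\rightsquigarrow\widetilde T_1^{\,k},$$ where $\widetilde T_1^{\,i}$ arises from $\widetilde T_1^{\,i-1}$ by a positive $\delta$-perturbation of the node $v_i$, with swept region $S_i$. The sequence satisfies the *filled-voids condition* at scale $\lambda$ if $S=S_{k_0}+\dots+S_k$ attains the infimum that defines $\mathbb{F}_\lambda(\widetilde T_1^{\,k}-T_0)$. **Corollary.** 1. There is $M_0=M_0(T_0)>0$ such that for all $\lambda>0$, all $0<\delta<M_0$, all $0\le k_0<k\le n$ and every sequence as above that satisfies the filled-voids condition, $$\mathbb{F}_\lambda(\widetilde T_1^{\,k}-T_0)=\sum_{i=k_0}^{k}\mathbb{F}_\lambda(\widetilde T_1^{\,i}-\widetilde T_1^{\,i-1}).\qquad(*)$$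 2. There is $\lambda_0=\lambda_0(T_0)>0$ such that for every $0<\lambda<\lambda_0$ there is $M=M_\lambda(T_0)>0$ such that for all $0<\delta<M$, all $1\le k_0<k\le n-1$ (only interior nodes are perturbed) and every sequence as above, the filled-voids condition is satisfied and hence $(*)$ holds. -/

import Mathlib

open MeasureTheory Set Metric
open scoped ENNReal

noncomputable section

namespace PlaneCurrent

/-- The Euclidean plane. -/
abbrev Plane : Type := EuclideanSpace ℝ (Fin 2)

/-- Smooth compactly supported differential forms of degree `d` on the plane. -/
def TestForm (d : ℕ) : Submodule ℝ (Plane → Plane [⋀^Fin d]→L[ℝ] ℝ) where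
  carrier := {φ | ContDiff ℝ (⊤ : ℕ∞) φ ∧ HasCompactSupport φ}
  add_mem' := fun h₁ h₂ => ⟨h₁.1.add h₂.1, h₁.2.add h₂.2⟩
  zero_mem' := ⟨contDiff_const, HasCompactSupport.zero⟩
  smul_mem' := fun c _ h => ⟨h.1.const_smul c, h.2.smul_left (f := fun _ => c)⟩

/-- The exterior derivative on test forms. -/
def extDerivTest (d : ℕ) : TestForm d →ₗ[ℝ] TestForm (d + 1) where
  toFun φ := ⟨extDeriv φ.1, by
    constructor
    · have h : ContDiff ℝ (⊤ : ℕ∞) (fderiv ℝ φ.1) := φ.2.1.fderiv_right (by simp)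
      exact (ContinuousAlternatingMap.alternatizeUncurryFinCLM ℝ Plane ℝ).contDiff.comp h
    · exact (φ.2.2.fderiv ℝ).comp_left (g := ContinuousAlternatingMap.alternatizeUncurryFinCLM
        (n := d) ℝ Plane ℝ) (map_zero _)⟩
  map_add' φ η := by
    ext1
    funext x
    exact extDeriv_add ((φ.2.1.differentiable (by simp)) x) ((η.2.1.differentiable (by simp)) x)
  map_smul' c φ := by
    ext1
    funext x
    exact extDeriv_smul c φ.1

/-- Linear functionals on test forms of degree `d`. No continuity is asked for here: all the
functionals considered below have finite mass, and those are automatically continuous, i.e. they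
are currents in the usual sense. -/
abbrev Current (d : ℕ) : Type := TestForm d →ₗ[ℝ] ℝ

/-- The boundary of a current, `(∂S)(φ) = S(dφ)`. -/
def boundary {d : ℕ} (S : Current (d + 1)) : Current d := S ∘ₗ extDerivTest d

/-- The mass (the `d`-dimensional volume, counted with multiplicity): the supremum of `T φ` over
the test forms of comass at most one. The operator norm of an alternating form on a Euclidean
space is its comass. -/
def mass {d : ℕ} (T : Current d) : ℝ≥0∞ :=
  ⨆ φ : {φ : TestForm d // ∀ x, ‖φ.1 x‖ ≤ 1}, ENNReal.ofReal (T φ.1)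

/-- The value of a two-form on the standard basis, i.e. the coefficient of `dx ∧ dy`. -/
def coeff (φ : TestForm 2) (x : Plane) : ℝ := φ.1 x (EuclideanSpace.basisFun (Fin 2) ℝ)

/-- Integral two-currents in the plane: compactly supported integer multiplicity rectifiable
currents, which in top dimension are given by an integrable integer valued density, whose
boundary has finite mass. -/
def IsIntegralCurrent (S : Current 2) : Prop :=
  (∃ θ : Plane → ℤ, HasCompactSupport θ ∧ Integrable (fun x => (θ x : ℝ)) ∧
    ∀ φ : TestForm 2, S φ = ∫ x, (θ x : ℝ) * coeff φ x) ∧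
  mass (boundary S) < ∞

/-- The value of the flat norm functional of `T` at the two-current `S`. -/
def flatCost (lam : ℝ) (T : Current 1) (S : Current 2) : ℝ≥0∞ :=
  mass (T - boundary S) + ENNReal.ofReal lam * mass S

/-- The multiscale flat norm of a one-current in the plane at scale `lam`. -/
def flatNorm (lam : ℝ) (T : Current 1) : ℝ≥0∞ :=
  ⨅ S : {S : Current 2 // IsIntegralCurrent S}, flatCost lam T S.1

theorem coeff_continuous (φ : TestForm 2) : Continuous (coeff φ) :=
  (ContinuousAlternatingMap.apply ℝ Plane ℝ (EuclideanSpace.basisFun (Fin 2) ℝ)).continuous.comp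
    φ.2.1.continuous

theorem coeff_integrable (φ : TestForm 2) : Integrable (coeff φ) :=
  (coeff_continuous φ).integrable_of_hasCompactSupport
    (φ.2.2.comp_left (g := fun f : Plane [⋀^Fin 2]→L[ℝ] ℝ =>
      f (EuclideanSpace.basisFun (Fin 2) ℝ)) rfl)

theorem edge_intervalIntegrable (a b : Plane) (φ : TestForm 1) :
    IntervalIntegrable (fun t : ℝ => φ.1 (a + t • (b - a)) (fun _ => b - a)) volume 0 1 := by
  apply Continuous.intervalIntegrable
  exact (ContinuousAlternatingMap.apply ℝ Plane ℝ (fun _ : Fin 1 => b - a)).continuous.comp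
    (φ.2.1.continuous.comp (by fun_prop))

/-- The one-current of the straight segment oriented from `a` to `b`. -/
def edge (a b : Plane) : Current 1 where
  toFun φ := ∫ t in (0 : ℝ)..1, φ.1 (a + t • (b - a)) (fun _ => b - a)
  map_add' φ η := by
    rw [← intervalIntegral.integral_add (edge_intervalIntegrable a b φ)
      (edge_intervalIntegrable a b η)]
    rfl
  map_smul' c φ := by
    rw [RingHom.id_apply, smul_eq_mul, ← intervalIntegral.integral_const_mul]
    rfl

/-- `det [x, y]ᵀ = x₁ y₂ - x₂ y₁`. -/
def det (x y : Plane) : ℝ := x 0 * y 1 - x 1 * y 0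

/-- The two-current of the triangle with vertices `a`, `b`, `c`, oriented by this order of the
vertices (zero if the triangle is degenerate). -/
def triangle (a b c : Plane) : Current 2 where
  toFun φ := Real.sign (det (b - a) (c - a)) * ∫ x in convexHull ℝ {a, b, c}, coeff φ x
  map_add' φ η := by
    rw [← mul_add, ← integral_add (coeff_integrable φ).integrableOn
      (coeff_integrable η).integrableOn]
    rfl
  map_smul' c φ := by
    rw [RingHom.id_apply, smul_eq_mul, mul_left_comm]
    congr 1
    rw [← integral_const_mul]
    rfl

/-- The sequence of nodes `v₀, …, vₙ` spans a simple piecewise linear curve: the nodes are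
distinct, consecutive edges meet only in their common node, and other edges do not meet. -/
def IsSimple {n : ℕ} (v : Fin (n + 1) → Plane) : Prop :=
  Function.Injective v ∧
  ∀ i j : Fin n, i < j → ∀ x, x ∈ segment ℝ (v i.castSucc) (v i.succ) →
    x ∈ segment ℝ (v j.castSucc) (v j.succ) → i.succ = j.castSucc ∧ x = v i.succ

/-- The PWL current `e₁ + ⋯ + eₙ` with nodes `v₀, …, vₙ`. -/
def pwl {n : ℕ} (v : Fin (n + 1) → Plane) : Current 1 :=
  ∑ j : Fin n, edge (v j.castSucc) (v j.succ)

/-- The support of the PWL current with nodes `v₀, …, vₙ`. -/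
def support {n : ℕ} (v : Fin (n + 1) → Plane) : Set Plane :=
  ⋃ j : Fin n, segment ℝ (v j.castSucc) (v j.succ)

/-- The positive cone at the node `i`: the points `x` of the open `δ`-ball around `v i` with
`det [x - v i, e]ᵀ > 0` for each edge `e` incident to `v i` (two edges at an interior node, one
at a boundary node). -/
def positiveCone {n : ℕ} (δ : ℝ) (v : Fin (n + 1) → Plane) (i : Fin (n + 1)) : Set Plane :=
  {x | x ∈ ball (v i) δ ∧ ∀ j : Fin n, j.castSucc = i ∨ j.succ = i →
    0 < det (x - v i) (v j.succ - v j.castSucc)}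

/-- The allowed region at the node `i`: the points `x` of the positive cone for which the new edges
joining `x` to the neighbours of `v i` meet the curve only in these neighbours. -/
def positiveRegion {n : ℕ} (δ : ℝ) (v : Fin (n + 1) → Plane) (i : Fin (n + 1)) : Set Plane :=
  {x | x ∈ positiveCone δ v i ∧
    (∀ j : Fin n, j.succ = i →
      segment ℝ (v j.castSucc) x ∩ support v ⊆ {v j.castSucc}) ∧
    (∀ j : Fin n, j.castSucc = i →
      segment ℝ x (v j.succ) ∩ support v ⊆ {v j.succ})}

/-- `w` arises from `v` by a positive `δ`-perturbation of the node `i`. -/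
def IsPositivePerturbation {n : ℕ} (δ : ℝ) (i : Fin (n + 1)) (v w : Fin (n + 1) → Plane) : Prop :=
  ∃ x ∈ positiveRegion δ v i, w = Function.update v i x

/-- `T k₀, T (k₀ + 1), …, T (k + 1)` are the node sequences of a sequence of currents which starts
at `v` and is induced by positive `δ`-perturbations of the adjacent nodes `k₀, k₀ + 1, …, k`, in
this order. So `T (i + 1)` is the outcome of the perturbation of the node `i` in `T i`. -/
def IsPositiveSequence {n : ℕ} (δ : ℝ) (k₀ k : Fin (n + 1)) (v : Fin (n + 1) → Plane)
    (T : ℕ → Fin (n + 1) → Plane) : Prop :=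
  T k₀ = v ∧ ∀ i : Fin (n + 1), k₀ ≤ i → i ≤ k → IsPositivePerturbation δ i (T i) (T (i + 1))

/-- The oriented region swept when the node `i` of `v` is moved to `x`: the sum of the triangles
spanned by `x` and the edges incident to `v i`, oriented such that the new edges are positive.
For an interior node with neighbours `p`, `q` this is the quadrilateral with boundary
`(p, x) + (x, q) - (v i, q) - (p, v i)`, for a boundary node it is a single triangle. -/
def sweptRegion {n : ℕ} (v : Fin (n + 1) → Plane) (i : Fin (n + 1)) (x : Plane) : Current 2 :=
  ∑ j : Fin n, ((if j.succ = i then triangle (v j.castSucc) x (v i) else 0) +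
    (if j.castSucc = i then triangle x (v j.succ) (v i) else 0))

/-- The void between the first and the last current of a sequence of perturbations of the nodes
`k₀, …, k`: the sum of the regions swept by the single perturbations. -/
def void {n : ℕ} (k₀ k : Fin (n + 1)) (T : ℕ → Fin (n + 1) → Plane) : Current 2 :=
  ∑ i ∈ Finset.Icc k₀ k, sweptRegion (T i) i (T (i + 1) i)

/-- The filled voids condition: filling the whole void with multiplicity one is an optimal
decomposition for the flat norm distance between the first and the last current. -/
def FilledVoids {n : ℕ} (lam : ℝ) (k₀ k : Fin (n + 1)) (T : ℕ → Fin (n + 1) → Plane) : Prop :=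
  IsIntegralCurrent (void k₀ k T) ∧
  flatCost lam (pwl (T (k + 1)) - pwl (T k₀)) (void k₀ k T) =
    flatNorm lam (pwl (T (k + 1)) - pwl (T k₀))

/-- The flat norm distance between the first and the last current of the sequence is the sum of
the flat norm distances between consecutive currents. -/
def IsAdditive {n : ℕ} (lam : ℝ) (k₀ k : Fin (n + 1)) (T : ℕ → Fin (n + 1) → Plane) : Prop :=
  flatNorm lam (pwl (T (k + 1)) - pwl (T k₀)) =
    ∑ i ∈ Finset.Icc k₀ k, flatNorm lam (pwl (T (i + 1)) - pwl (T i))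

end PlaneCurrent

end

open PlaneCurrent

/-!
The regions swept by the perturbations are positive two-currents, so their areas add up. The
boundary of a swept region is the difference of the new and the old curve, except when an end of
the curve is moved; then the residual is carried by a small neighbourhood of that end. As the two
ends are far apart, the lengths of the residuals add up as well. Hence the cost of the whole void is
the sum of the costs of the swept regions. If it is optimal, it therefore bounds the sum of the flat
norms from above, and subadditivity of the flat norm gives the converse inequality.

When only interior nodes are moved there is no residual, and a calibration shows that the void is
optimal: all swept regions lie in a bounded convex set, on which the area form has a compactly
supported primitive `ω` with `dω` of comass at most one everywhere. Once `lam` is so small that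
`lam ω` has comass at most one as well, testing with `ω` bounds the cost of every filling from
below.
-/

namespace PlaneCurrent

theorem topForm_apply (η : Plane [⋀^Fin 2]→L[ℝ] ℝ) (u : Fin 2 → Plane) :
    η u = det (u 0) (u 1) * η (EuclideanSpace.basisFun (Fin 2) ℝ) := by
  have h := congrArg (· u) <| AlternatingMap.eq_smul_basis_det
    (EuclideanSpace.basisFun (Fin 2) ℝ).toBasis η.toAlternatingMap
  simp only [AlternatingMap.smul_apply, Module.Basis.det_apply, Matrix.det_fin_two,
    Module.Basis.toMatrix_apply, OrthonormalBasis.coe_toBasis_repr_apply,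
    EuclideanSpace.basisFun_repr, OrthonormalBasis.coe_toBasis, smul_eq_mul] at h
  rw [det, mul_comm, mul_comm (u 0 1)]
  exact h

theorem abs_det_le (x y : Plane) : |det x y| ≤ ‖x‖ * ‖y‖ := by
  rw [EuclideanSpace.norm_eq, EuclideanSpace.norm_eq, ← Real.sqrt_mul (by positivity)]
  apply Real.abs_le_sqrt
  simp only [Fin.sum_univ_two, Real.norm_eq_abs, sq_abs, det]
  nlinarith only [sq_nonneg (x 0 * y 0 + x 1 * y 1)]

theorem norm_eq_abs_coeff (φ : TestForm 2) (x : Plane) : ‖φ.1 x‖ = |coeff φ x| := by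
  apply le_antisymm
  · refine (φ.1 x).opNorm_le_bound (abs_nonneg _) fun u => ?_
    rw [topForm_apply, norm_mul, mul_comm, Fin.prod_univ_two]
    exact mul_le_mul_of_nonneg_left (abs_det_le _ _) (abs_nonneg _)
  · simpa [coeff] using (φ.1 x).le_opNorm (EuclideanSpace.basisFun (Fin 2) ℝ)

theorem extDeriv_one_apply (ω : Plane → Plane [⋀^Fin 1]→L[ℝ] ℝ) (x : Plane) (u : Fin 2 → Plane) :
    extDeriv ω x u = fderiv ℝ ω x (u 0) (fun _ => u 1) - fderiv ℝ ω x (u 1) (fun _ => u 0) := by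
  have h₀ : (0 : Fin 2).removeNth u = fun _ => u 1 := by ext1 i; fin_cases i; rfl
  have h₁ : (1 : Fin 2).removeNth u = fun _ => u 0 := by ext1 i; fin_cases i; rfl
  rw [extDeriv, ContinuousAlternatingMap.alternatizeUncurryFin_apply, Fin.sum_univ_two, h₀, h₁]
  simp [sub_eq_add_neg]

theorem det_mul_coeff_extDerivTest (ω : TestForm 1) (x u w : Plane) :
    det u w * coeff (extDerivTest 1 ω) x =
      fderiv ℝ ω.1 x u (fun _ => w) - fderiv ℝ ω.1 x w (fun _ => u) :=
  (topForm_apply _ ![u, w]).symm.trans (extDeriv_one_apply ω.1 x _)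

section Mass

variable {d : ℕ}

theorem ofReal_apply_le_mass (T : Current d) (φ : TestForm d) (hφ : ∀ x, ‖φ.1 x‖ ≤ 1) :
    ENNReal.ofReal (T φ) ≤ mass T :=
  le_iSup (fun φ : {φ : TestForm d // ∀ x, ‖φ.1 x‖ ≤ 1} => ENNReal.ofReal (T φ.1)) ⟨φ, hφ⟩

theorem mass_zero : mass (0 : Current d) = 0 := by
  simp [mass]

theorem mass_add_le (T U : Current d) : mass (T + U) ≤ mass T + mass U :=
  iSup_le fun φ => ENNReal.ofReal_add_le.trans
    (add_le_add (ofReal_apply_le_mass T φ.1 φ.2) (ofReal_apply_le_mass U φ.1 φ.2))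

theorem mass_edge_lt_top (a b : Plane) : mass (edge a b) < ∞ := by
  refine (iSup_le fun φ => ENNReal.ofReal_le_ofReal ?_).trans_lt
    (ENNReal.ofReal_lt_top (r := ‖b - a‖))
  calc edge a b φ.1
    _ ≤ ‖∫ t in (0 : ℝ)..1, φ.1.1 (a + t • (b - a)) (fun _ => b - a)‖ := Real.le_norm_self _
    _ ≤ ‖b - a‖ * |1 - 0| := intervalIntegral.norm_integral_le_of_norm_le_const fun t _ => by
      simpa using (φ.1.1 (a + t • (b - a))).le_of_opNorm_le (φ.2 _) fun _ => b - a
    _ = ‖b - a‖ := by simp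

end Mass

section FlatNorm

theorem boundary_add {d : ℕ} (S U : Current (d + 1)) :
    boundary (S + U) = boundary S + boundary U :=
  LinearMap.add_comp _ _ _

theorem boundary_zero {d : ℕ} : boundary (0 : Current (d + 1)) = 0 :=
  LinearMap.zero_comp _

theorem boundary_sum {d : ℕ} {ι : Type*} (s : Finset ι) (S : ι → Current (d + 1)) :
    boundary (∑ i ∈ s, S i) = ∑ i ∈ s, boundary (S i) :=
  map_sum (LinearMap.lcomp ℝ ℝ (extDerivTest d)) S s

theorem integrable_mul_coeff {θ : Plane → ℝ} (hθ : Integrable θ) (φ : TestForm 2) :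
    Integrable fun x => θ x * coeff φ x := by
  obtain ⟨C, hC⟩ := φ.2.2.exists_bound_of_continuous φ.2.1.continuous
  exact hθ.mul_bdd (coeff_continuous φ).aestronglyMeasurable
    (.of_forall fun x => (norm_eq_abs_coeff φ x).symm.trans_le (hC x))

theorem IsIntegralCurrent.zero : IsIntegralCurrent 0 :=
  ⟨⟨0, .zero, by simp, by simp⟩, by simp [boundary_zero, mass_zero]⟩

theorem IsIntegralCurrent.add {S U : Current 2} (hS : IsIntegralCurrent S)
    (hU : IsIntegralCurrent U) : IsIntegralCurrent (S + U) := by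
  obtain ⟨⟨θ, hθ_supp, hθ_int, hθ⟩, hS_bdry⟩ := hS
  obtain ⟨⟨η, hη_supp, hη_int, hη⟩, hU_bdry⟩ := hU
  refine ⟨⟨θ + η, hθ_supp.add hη_supp, by simpa using hθ_int.fun_add hη_int, fun φ => ?_⟩, ?_⟩
  · rw [LinearMap.add_apply, hθ, hη,
      ← integral_add (integrable_mul_coeff hθ_int φ) (integrable_mul_coeff hη_int φ)]
    simp [add_mul]
  · rw [boundary_add]
    exact (mass_add_le _ _).trans_lt (ENNReal.add_lt_top.2 ⟨hS_bdry, hU_bdry⟩)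

theorem IsIntegralCurrent.sum {ι : Type*} {s : Finset ι} {S : ι → Current 2}
    (hS : ∀ i ∈ s, IsIntegralCurrent (S i)) : IsIntegralCurrent (∑ i ∈ s, S i) :=
  Finset.sum_induction _ _ (fun _ _ => .add) .zero hS

theorem flatNorm_le_flatCost (lam : ℝ) (T : Current 1) {S : Current 2}
    (hS : IsIntegralCurrent S) : flatNorm lam T ≤ flatCost lam T S :=
  iInf_le (fun S : {S : Current 2 // IsIntegralCurrent S} => flatCost lam T S.1) ⟨S, hS⟩

theorem flatNorm_zero (lam : ℝ) : flatNorm lam 0 = 0 := by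
  simpa [flatCost, boundary_zero, mass_zero] using flatNorm_le_flatCost lam 0 .zero

theorem flatCost_add_le (lam : ℝ) (T U : Current 1) (S R : Current 2) :
    flatCost lam (T + U) (S + R) ≤ flatCost lam T S + flatCost lam U R := by
  rw [flatCost, boundary_add, add_sub_add_comm]
  refine (add_le_add (mass_add_le _ _) (mul_le_mul_right (mass_add_le _ _) _)).trans_eq ?_
  rw [mul_add, add_add_add_comm, flatCost, flatCost]

theorem flatNorm_add_le (lam : ℝ) (T U : Current 1) :
    flatNorm lam (T + U) ≤ flatNorm lam T + flatNorm lam U :=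
  ENNReal.le_iInf_add_iInf fun S R =>
    (flatNorm_le_flatCost lam _ (S.2.add R.2)).trans (flatCost_add_le lam T U S.1 R.1)

theorem flatNorm_sum_le {ι : Type*} (lam : ℝ) (s : Finset ι) (T : ι → Current 1) :
    flatNorm lam (∑ i ∈ s, T i) ≤ ∑ i ∈ s, flatNorm lam (T i) :=
  Finset.le_sum_of_subadditive (flatNorm lam) (flatNorm_zero lam).le (flatNorm_add_le lam) s T

theorem flatNorm_sum_eq {ι : Type*} {lam : ℝ} {s : Finset ι} {T : ι → Current 1}
    {S : ι → Current 2} (hS : ∀ i ∈ s, IsIntegralCurrent (S i))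
    (h_residual : ∑ i ∈ s, mass (T i - boundary (S i)) ≤
      mass (∑ i ∈ s, (T i - boundary (S i))))
    (h_filling : ∑ i ∈ s, mass (S i) ≤ mass (∑ i ∈ s, S i))
    (h_optimal : flatCost lam (∑ i ∈ s, T i) (∑ i ∈ s, S i) ≤ flatNorm lam (∑ i ∈ s, T i)) :
    flatNorm lam (∑ i ∈ s, T i) = ∑ i ∈ s, flatNorm lam (T i) := by
  refine (flatNorm_sum_le lam s T).antisymm ?_
  calc ∑ i ∈ s, flatNorm lam (T i)
    _ ≤ ∑ i ∈ s, flatCost lam (T i) (S i) :=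
      Finset.sum_le_sum fun i hi => flatNorm_le_flatCost lam _ (hS i hi)
    _ = ∑ i ∈ s, mass (T i - boundary (S i)) + ENNReal.ofReal lam * ∑ i ∈ s, mass (S i) := by
      simp only [flatCost, Finset.sum_add_distrib, Finset.mul_sum]
    _ ≤ flatCost lam (∑ i ∈ s, T i) (∑ i ∈ s, S i) := by
      rw [flatCost, boundary_sum, ← Finset.sum_sub_distrib]
      gcongr
    _ ≤ flatNorm lam (∑ i ∈ s, T i) := h_optimal

end FlatNorm

section Calibration

/-- `S` is monotone in the coefficient of the test form on `K`: a positive two-current carried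
by `K`. Unlike a nonnegative density this is immediately stable under sums. -/
def IsPositiveOn (K : Set Plane) (S : Current 2) : Prop :=
  ∀ φ ψ : TestForm 2, (∀ x ∈ K, coeff φ x ≤ coeff ψ x) → S φ ≤ S ψ

theorem IsPositiveOn.zero (K : Set Plane) : IsPositiveOn K 0 :=
  fun _ _ _ => le_rfl

theorem IsPositiveOn.add {K : Set Plane} {S U : Current 2} (hS : IsPositiveOn K S)
    (hU : IsPositiveOn K U) : IsPositiveOn K (S + U) :=
  fun φ ψ h => add_le_add (hS φ ψ h) (hU φ ψ h)

theorem IsPositiveOn.sum {K : Set Plane} {ι : Type*} {s : Finset ι} {S : ι → Current 2}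
    (hS : ∀ i ∈ s, IsPositiveOn K (S i)) : IsPositiveOn K (∑ i ∈ s, S i) :=
  Finset.sum_induction _ _ (fun _ _ => .add) (.zero K) hS

/-- The two-form `φ` calibrates `K`, positively oriented: it has comass at most one and agrees
with the area form on `K`. -/
structure IsCalibration (K : Set Plane) (φ : TestForm 2) : Prop where
  norm_le_one : ∀ x, ‖φ.1 x‖ ≤ 1
  coeff_eq_one : ∀ x ∈ K, coeff φ x = 1

variable {K : Set Plane} {S : Current 2} {φ : TestForm 2}

theorem IsCalibration.apply_nonneg (hφ : IsCalibration K φ) (hS : IsPositiveOn K S) :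
    0 ≤ S φ := by
  rw [← map_zero S]
  exact hS 0 φ fun x hx => zero_le_one.trans (hφ.coeff_eq_one x hx).ge

theorem IsCalibration.mass_eq (hφ : IsCalibration K φ) (hS : IsPositiveOn K S) :
    mass S = ENNReal.ofReal (S φ) := by
  refine le_antisymm (iSup_le fun ψ => ENNReal.ofReal_le_ofReal (hS ψ.1 φ fun x hx => ?_))
    (ofReal_apply_le_mass S φ hφ.norm_le_one)
  rw [hφ.coeff_eq_one x hx]
  exact (le_abs_self _).trans ((norm_eq_abs_coeff ψ.1 x).symm.trans_le (ψ.2 x))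

theorem IsCalibration.sum_mass_eq (hφ : IsCalibration K φ) {ι : Type*} {s : Finset ι}
    {S : ι → Current 2} (hS : ∀ i ∈ s, IsPositiveOn K (S i)) :
    ∑ i ∈ s, mass (S i) = mass (∑ i ∈ s, S i) := by
  rw [hφ.mass_eq (.sum hS), LinearMap.sum_apply,
    ENNReal.ofReal_sum_of_nonneg fun i hi => hφ.apply_nonneg (hS i hi)]
  exact Finset.sum_congr rfl fun i hi => hφ.mass_eq (hS i hi)

/-- Since `lam (dω)(S) = (∂S - ∂U)(lam ω) + lam (dω)(U)`, the bounds on the comass of `lam ω`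
and of `dω` make `S` cheaper than any competitor `U`. -/
theorem IsCalibration.flatCost_le {ω : TestForm 1} (hω : IsCalibration K (extDerivTest 1 ω))
    (hS : IsPositiveOn K S) {lam : ℝ} (hlam : 0 ≤ lam) (hlamω : ∀ x, lam * ‖ω.1 x‖ ≤ 1)
    (U : Current 2) : flatCost lam (boundary S) S ≤ flatCost lam (boundary S) U := by
  have h_stokes : lam * S (extDerivTest 1 ω) =
      (boundary S - boundary U) (lam • ω) + lam * U (extDerivTest 1 ω) := by
    simp only [LinearMap.sub_apply, map_smul, smul_eq_mul, boundary, LinearMap.comp_apply]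
    ring
  have h_norm : ∀ x, ‖(lam • ω).1 x‖ ≤ 1 := fun x => by
    simpa [norm_smul, abs_of_nonneg hlam] using hlamω x
  calc flatCost lam (boundary S) S
    _ = ENNReal.ofReal (lam * S (extDerivTest 1 ω)) := by
      rw [flatCost, sub_self, mass_zero, zero_add, hω.mass_eq hS, ENNReal.ofReal_mul hlam]
    _ ≤ ENNReal.ofReal ((boundary S - boundary U) (lam • ω)) +
        ENNReal.ofReal lam * ENNReal.ofReal (U (extDerivTest 1 ω)) := by
      rw [h_stokes, ← ENNReal.ofReal_mul hlam]
      exact ENNReal.ofReal_add_le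
    _ ≤ flatCost lam (boundary S) U := by
      rw [flatCost]
      gcongr
      · exact ofReal_apply_le_mass _ _ h_norm
      · exact ofReal_apply_le_mass U _ hω.norm_le_one

theorem exists_contDiff_deriv_eq_one (R : ℝ) : ∃ f : ℝ → ℝ, ContDiff ℝ (⊤ : ℕ∞) f ∧
    HasCompactSupport f ∧ (∀ x, |deriv f x| ≤ 1) ∧ ∀ x, |x| ≤ R → deriv f x = 1 := by
  obtain ⟨r, hRr, hr⟩ : ∃ r, R ≤ r ∧ 0 < r := ⟨max R 1, le_max_left _ _, by positivity⟩
  let b : ContDiffBump (0 : ℝ) := ⟨r, 2 * r, hr, by linarith⟩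
  have hb_zero : ∀ x, 2 * r ≤ |x| → b x = 0 := fun x hx => b.zero_of_le_dist (by simpa using hx)
  -- Subtracting the translate of `b` makes the integral vanish on the right as well.
  let f : ℝ → ℝ := fun x => ∫ t in (x - 3 * r)..x, b t
  have hf : ∀ x, HasDerivAt f (b x - b (x - 3 * r)) x := fun x => by
    have hB : ∀ y, HasDerivAt (fun y => ∫ t in (0 : ℝ)..y, b t) (b y) y := fun y =>
      (b.continuous.integral_hasStrictDerivAt 0 y).hasDerivAt
    refine ((hB x).sub ((hB (x - 3 * r)).comp_sub_const x (3 * r))).congr_of_eventuallyEq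
      (.of_forall fun y => ?_)
    exact (intervalIntegral.integral_interval_sub_left (b.continuous.intervalIntegrable _ _)
      (b.continuous.intervalIntegrable _ _)).symm
  have hf_deriv : deriv f = fun x => b x - b (x - 3 * r) := funext fun x => (hf x).deriv
  refine ⟨f, ?_, .intro (isCompact_Icc (a := -2 * r) (b := 5 * r)) fun x hx => ?_,
    fun x => ?_, fun x hx => ?_⟩
  · rw [contDiff_infty_iff_deriv, hf_deriv]
    exact ⟨fun x => (hf x).differentiableAt,
      b.contDiff.sub (b.contDiff.comp (contDiff_id.sub contDiff_const))⟩
  · refine intervalIntegral.integral_zero_ae (.of_forall fun t ht => hb_zero t ?_)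
    rw [uIoc_of_le (by linarith), mem_Ioc] at ht
    rw [mem_Icc, not_and_or] at hx
    rw [le_abs]
    grind
  · rw [hf_deriv, abs_le]
    constructor <;> linarith [b.nonneg (x := x), b.le_one (x := x), b.nonneg (x := x - 3 * r),
      b.le_one (x := x - 3 * r)]
  · have hx' : |x| ≤ r := hx.trans hRr
    have h_left : b x = 1 := b.one_of_mem_closedBall (by simpa using hx')
    have h_right : b (x - 3 * r) = 0 := hb_zero _ (by
      rw [abs_le] at hx'
      exact le_abs.2 (.inr (by linarith)))
    simp only [hf_deriv, h_left, h_right, sub_zero]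

end Calibration

theorem hasCompactSupport_mul_coord {f g : ℝ → ℝ} (hf : HasCompactSupport f)
    (hg : HasCompactSupport g) : HasCompactSupport fun x : Plane => f (x 0) * g (x 1) := by
  refine .intro (K := (PiLp.homeomorph 2 fun _ : Fin 2 => ℝ) ⁻¹'
    univ.pi ![tsupport f, tsupport g]) ?_ fun x hx => ?_
  · refine (PiLp.homeomorph 2 _).isCompact_preimage.2
      (isCompact_univ_pi fun i => ?_)
    fin_cases i
    exacts [hf, hg]
  · rw [mul_eq_zero]
    by_contra! h
    refine hx fun i _ => ?_
    fin_cases i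
    exacts [subset_tsupport f h.1, subset_tsupport g h.2]

theorem exists_isCalibration_extDerivTest {K : Set Plane} (hK : Bornology.IsBounded K) :
    ∃ ω : TestForm 1, IsCalibration K (extDerivTest 1 ω) := by
  obtain ⟨R, hR⟩ := hK.exists_norm_le
  obtain ⟨f, hf_smooth, hf_supp, hf_deriv_le, hf_deriv_eq⟩ := exists_contDiff_deriv_eq_one R
  let dy : Plane [⋀^Fin 1]→L[ℝ] ℝ :=
    ContinuousAlternatingMap.ofSubsingleton ℝ Plane ℝ 0 (EuclideanSpace.proj (1 : Fin 2))
  let g : Plane → ℝ := fun x => f (x 0) * deriv f (x 1)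
  have hf'_smooth : ContDiff ℝ (⊤ : ℕ∞) (deriv f) := (contDiff_infty_iff_deriv.1 hf_smooth).2
  have hg_smooth : ContDiff ℝ (⊤ : ℕ∞) g := by fun_prop
  let ω : TestForm 1 := ⟨fun x => g x • dy, hg_smooth.smul contDiff_const,
    (hasCompactSupport_mul_coord hf_supp hf_supp.deriv).smul_right⟩
  have h_coeff : ∀ x, coeff (extDerivTest 1 ω) x = deriv f (x 0) * deriv f (x 1) := fun x => by
    have hg : HasFDerivAt g (f (x 0) • deriv (deriv f) (x 1) • EuclideanSpace.proj (1 : Fin 2) +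
        deriv f (x 1) • deriv f (x 0) • EuclideanSpace.proj (0 : Fin 2)) x :=
      ((hf_smooth.differentiable (by simp) _).hasDerivAt.comp_hasFDerivAt x
        (EuclideanSpace.proj (0 : Fin 2) : Plane →L[ℝ] ℝ).hasFDerivAt).mul
      ((hf'_smooth.differentiable (by simp) _).hasDerivAt.comp_hasFDerivAt x
        (EuclideanSpace.proj (1 : Fin 2) : Plane →L[ℝ] ℝ).hasFDerivAt)
    have h_ext : coeff (extDerivTest 1 ω) x = _ := extDeriv_one_apply ω.1 x _
    rw [h_ext, (hg.smul_const dy).fderiv]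
    simp [dy, mul_comm]
  refine ⟨ω, fun x => ?_, fun x hx => ?_⟩
  · rw [norm_eq_abs_coeff, h_coeff, abs_mul]
    exact mul_le_one₀ (hf_deriv_le _) (abs_nonneg _) (hf_deriv_le _)
  · have h_le : ∀ i, |x i| ≤ R := fun i => (PiLp.norm_apply_le x i).trans (hR x hx)
    rw [h_coeff, hf_deriv_eq _ (h_le 0), hf_deriv_eq _ (h_le 1), one_mul]

section Simplex

variable {F : Type*} [NormedAddCommGroup F] [NormedSpace ℝ F]

/-- The standard triangle with vertices `(0, 0)`, `(1, 0)`, `(0, 1)`, the parameter domain of all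
triangles. -/
def simplex : Set (ℝ × ℝ) := {p | 0 ≤ p.1 ∧ 0 ≤ p.2 ∧ p.1 + p.2 ≤ 1}

theorem isCompact_simplex : IsCompact simplex := by
  refine (isCompact_Icc (a := ((0 : ℝ), (0 : ℝ))) (b := (1, 1))).of_isClosed_subset ?_ ?_
  · exact (isClosed_le continuous_const continuous_fst).inter
      ((isClosed_le continuous_const continuous_snd).inter
        (isClosed_le (continuous_fst.add continuous_snd) continuous_const))
  · rintro ⟨s, t⟩ ⟨hs, ht, hst⟩
    constructor <;> constructor <;> simp only at * <;> linarith

theorem setIntegral_simplex_swap (h : ℝ × ℝ → F) :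
    ∫ p in simplex, h p.swap = ∫ p in simplex, h p := by
  have h_symm : Prod.swap ⁻¹' simplex = simplex := by
    ext p
    simp only [simplex, mem_preimage, mem_ofPred_eq, Prod.fst_swap, Prod.snd_swap,
      add_comm p.2 p.1, and_left_comm]
  conv_lhs => rw [← h_symm]
  exact (Measure.measurePreserving_swap (μ := (volume : Measure ℝ))
    (ν := (volume : Measure ℝ))).setIntegral_preimage_emb
      MeasurableEquiv.prodComm.measurableEmbedding h simplex

theorem setIntegral_simplex {h : ℝ × ℝ → F} (hh : IntegrableOn h simplex) :
    ∫ p in simplex, h p = ∫ s in (0 : ℝ)..1, ∫ t in (0 : ℝ)..(1 - s), h (s, t) := by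
  have h_meas : MeasurableSet simplex := isCompact_simplex.isClosed.measurableSet
  have h_int : Integrable (simplex.indicator h) (volume.prod volume) :=
    (integrable_indicator_iff h_meas).2 hh
  have h_slice : ∀ s, ∫ t, simplex.indicator h (s, t) =
      (Icc (0 : ℝ) 1).indicator (fun s => ∫ t in (0 : ℝ)..(1 - s), h (s, t)) s := fun s => by
    by_cases hs : s ∈ Icc (0 : ℝ) 1
    · have h_eq : (fun t => simplex.indicator h (s, t)) =
          (Icc 0 (1 - s)).indicator fun t => h (s, t) := by
        ext t
        simp only [indicator, simplex, mem_ofPred_eq, mem_Icc]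
        congr 1
        grind
      rw [indicator_of_mem hs, intervalIntegral.integral_of_le (sub_nonneg.2 hs.2),
        ← integral_Icc_eq_integral_Ioc, ← integral_indicator measurableSet_Icc, h_eq]
    · rw [indicator_of_notMem hs]
      refine integral_eq_zero_of_ae (.of_forall fun t => indicator_of_notMem (fun hst => hs ?_) _)
      exact ⟨hst.1, (le_add_of_nonneg_right hst.2.1).trans hst.2.2⟩
  rw [← integral_indicator h_meas, Measure.volume_eq_prod, integral_prod _ h_int,
    intervalIntegral.integral_of_le zero_le_one, ← integral_Icc_eq_integral_Ioc,
    ← integral_indicator measurableSet_Icc]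
  exact integral_congr_ae (.of_forall h_slice)

end Simplex

section Stokes

variable {E F : Type*} [NormedAddCommGroup E] [NormedSpace ℝ E] [NormedAddCommGroup F]
  [NormedSpace ℝ F]

/-- The mean value of `f` on the segment from `a` to `b`, parametrized with constant speed. -/
noncomputable def segmentMean (f : E → F) (a b : E) : F :=
  ∫ t in (0 : ℝ)..1, f (a + t • (b - a))

theorem segmentMean_swap (f : E → F) (a b : E) : segmentMean f b a = segmentMean f a b := by
  have h := intervalIntegral.integral_comp_sub_left (a := 0) (b := 1)
    (fun t : ℝ => f (a + t • (b - a))) 1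
  rw [sub_self, sub_zero] at h
  rw [segmentMean, segmentMean, ← h]
  refine intervalIntegral.integral_congr fun t _ => congrArg f ?_
  module

theorem segmentMean_sub {f g : E → F} (hf : Continuous f) (hg : Continuous g) (a b : E) :
    segmentMean (f - g) a b = segmentMean f a b - segmentMean g a b :=
  intervalIntegral.integral_sub (Continuous.intervalIntegrable (by fun_prop) _ _)
    (Continuous.intervalIntegrable (by fun_prop) _ _)

theorem integral_fderiv_line [CompleteSpace F] {f : E → F} (hf : ContDiff ℝ 1 f) (x w : E)
    (r : ℝ) : ∫ t in (0 : ℝ)..r, fderiv ℝ f (x + t • w) w = f (x + r • w) - f x := by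
  have h_deriv : ∀ t : ℝ, HasDerivAt (fun t : ℝ => f (x + t • w)) (fderiv ℝ f (x + t • w) w) t :=
    fun t => (hf.differentiable one_ne_zero _).hasFDerivAt.comp_hasDerivAt t
      (by simpa using ((hasDerivAt_id t).smul_const w).const_add x)
  have := hf.continuous_fderiv one_ne_zero
  rw [intervalIntegral.integral_eq_sub_of_hasDerivAt (fun t _ => h_deriv t)
    (Continuous.intervalIntegrable (by fun_prop) _ _), zero_smul, add_zero]

theorem setIntegral_simplex_fderiv_right [CompleteSpace F] {f : E → F} (hf : ContDiff ℝ 1 f)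
    (a b c : E) :
    ∫ p in simplex, fderiv ℝ f (a + (p.1 • (b - a) + p.2 • (c - a))) (c - a) =
      segmentMean f b c - segmentMean f a b := by
  have := hf.continuous_fderiv one_ne_zero
  have h_inner : ∀ s : ℝ, ∫ t in (0 : ℝ)..(1 - s),
      fderiv ℝ f (a + (s • (b - a) + t • (c - a))) (c - a) =
        f (c + s • (b - c)) - f (a + s • (b - a)) := fun s => by
    simp only [← add_assoc a]
    rw [integral_fderiv_line hf]
    congr 2
    module
  rw [setIntegral_simplex (ContinuousOn.integrableOn_compact isCompact_simplex
    (Continuous.continuousOn (by fun_prop))), ← segmentMean_swap f b c]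
  simp only [h_inner]
  have hf_cont := hf.continuous
  exact intervalIntegral.integral_sub (Continuous.intervalIntegrable (by fun_prop) _ _)
    (Continuous.intervalIntegrable (by fun_prop) _ _)

theorem setIntegral_simplex_fderiv_left [CompleteSpace F] {f : E → F} (hf : ContDiff ℝ 1 f)
    (a b c : E) :
    ∫ p in simplex, fderiv ℝ f (a + (p.1 • (b - a) + p.2 • (c - a))) (b - a) =
      segmentMean f b c - segmentMean f a c := by
  rw [← setIntegral_simplex_swap, ← segmentMean_swap f b c,
    ← setIntegral_simplex_fderiv_right hf a c b]
  simp only [Prod.fst_swap, Prod.snd_swap, add_comm]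

/-- The interior product of a one-form with a constant vector field. -/
def contract (φ : TestForm 1) (z : Plane) (x : Plane) : ℝ := φ.1 x fun _ => z

theorem contDiff_contract (φ : TestForm 1) (z : Plane) :
    ContDiff ℝ (⊤ : ℕ∞) (contract φ z) :=
  (ContinuousAlternatingMap.apply ℝ Plane ℝ fun _ : Fin 1 => z).contDiff.comp φ.2.1

theorem fderiv_contract_apply (φ : TestForm 1) (z x u : Plane) :
    fderiv ℝ (contract φ z) x u = fderiv ℝ φ.1 x u fun _ => z :=
  congrArg (· u) (((ContinuousAlternatingMap.apply ℝ Plane ℝ fun _ => z).hasFDerivAt.comp x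
    (φ.2.1.differentiable (by simp) x).hasFDerivAt).fderiv)

theorem contract_sub (φ : TestForm 1) (y z : Plane) :
    contract φ (y - z) = contract φ y - contract φ z :=
  funext fun x => ((ContinuousAlternatingMap.ofSubsingleton ℝ Plane ℝ (0 : Fin 1)).symm
    (φ.1 x)).map_sub y z

theorem segmentMean_contract_sub (φ : TestForm 1) (y z a b : Plane) :
    segmentMean (contract φ (y - z)) a b =
      segmentMean (contract φ y) a b - segmentMean (contract φ z) a b := by
  rw [contract_sub, segmentMean_sub (contDiff_contract φ y).continuous
    (contDiff_contract φ z).continuous]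

theorem edge_apply (a b : Plane) (φ : TestForm 1) :
    edge a b φ = segmentMean (contract φ b) a b - segmentMean (contract φ a) a b :=
  segmentMean_contract_sub φ b a a b

theorem edge_swap (a b : Plane) : edge b a = -edge a b := by
  ext φ
  rw [LinearMap.neg_apply, edge_apply, edge_apply, segmentMean_swap _ a b,
    segmentMean_swap _ a b, neg_sub]

theorem det_mul_setIntegral_coeff_extDerivTest (φ : TestForm 1) (a b c : Plane) :
    det (b - a) (c - a) *
      ∫ p in simplex, coeff (extDerivTest 1 φ) (a + (p.1 • (b - a) + p.2 • (c - a))) =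
    (edge a b + edge b c + edge c a) φ := by
  have hφ : ∀ z, ContDiff ℝ 1 (contract φ z) := fun z => (contDiff_contract φ z).of_le (by simp)
  have h_int : ∀ z u, IntegrableOn
      (fun p : ℝ × ℝ => fderiv ℝ (contract φ z) (a + (p.1 • (b - a) + p.2 • (c - a))) u)
      simplex := fun z u => by
    have := (hφ z).continuous_fderiv one_ne_zero
    exact ContinuousOn.integrableOn_compact isCompact_simplex
      (Continuous.continuousOn (by fun_prop))
  simp only [← integral_const_mul, det_mul_coeff_extDerivTest, ← fderiv_contract_apply]
  rw [integral_sub (h_int _ _) (h_int _ _), setIntegral_simplex_fderiv_left (hφ _),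
    setIntegral_simplex_fderiv_right (hφ _), edge_swap a c]
  simp only [LinearMap.add_apply, LinearMap.neg_apply, edge_apply, segmentMean_contract_sub]
  ring

end Stokes

section Triangle

theorem image_simplex_eq_convexHull {E : Type*} [AddCommGroup E] [Module ℝ E] (a b c : E) :
    (fun p : ℝ × ℝ => a + (p.1 • (b - a) + p.2 • (c - a))) '' simplex =
      convexHull ℝ {a, b, c} := by
  apply Subset.antisymm
  · rintro _ ⟨⟨s, t⟩, ⟨hs, ht, hst⟩, rfl⟩
    simp only at hs ht hst ⊢
    have h := (convex_convexHull ℝ {a, b, c}).sum_mem (t := Finset.univ)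
      (w := ![1 - s - t, s, t]) (z := ![a, b, c])
      (fun i _ => by fin_cases i <;> simp <;> linarith) (by simp [Fin.sum_univ_three]; ring)
      (fun i _ => subset_convexHull ℝ _ (by fin_cases i <;> simp))
    convert h using 1
    simp only [Fin.sum_univ_three, Matrix.cons_val]
    module
  · rw [convexHull_insert (insert_nonempty _ _), convexHull_pair, convexJoin_singleton_left]
    simp only [segment_eq_image, iUnion_subset_iff, image_subset_iff, mem_image]
    rintro _ ⟨η, ⟨hη₀, hη₁⟩, rfl⟩ θ ⟨hθ₀, hθ₁⟩
    refine ⟨(θ * (1 - η), θ * η), ⟨mul_nonneg hθ₀ (sub_nonneg.2 hη₁), mul_nonneg hθ₀ hη₀, ?_⟩, ?_⟩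
    · linarith
    · simp only
      module

/-- The linear map which sends the standard basis to `u` and `w`. -/
noncomputable def planeFrame (u w : Plane) : Plane →L[ℝ] Plane :=
  (EuclideanSpace.proj (0 : Fin 2) : Plane →L[ℝ] ℝ).smulRight u +
    (EuclideanSpace.proj (1 : Fin 2) : Plane →L[ℝ] ℝ).smulRight w

theorem det_planeFrame (u w : Plane) : (planeFrame u w).det = det u w := by
  rw [ContinuousLinearMap.det,
    ← LinearMap.det_toMatrix (EuclideanSpace.basisFun (Fin 2) ℝ).toBasis, Matrix.det_fin_two]
  simp [LinearMap.toMatrix_apply, planeFrame, det, mul_comm]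

theorem planeFrame_injective {u w : Plane} (h : det u w ≠ 0) :
    Function.Injective (planeFrame u w) :=
  ((planeFrame u w).toContinuousLinearEquivOfDetNeZero (by rwa [det_planeFrame])).injective

theorem setIntegral_convexHull_triple {F : Type*} [NormedAddCommGroup F] [NormedSpace ℝ F]
    {a b c : Plane} (h : det (b - a) (c - a) ≠ 0) (g : Plane → F) :
    ∫ x in convexHull ℝ {a, b, c}, g x = |det (b - a) (c - a)| •
      ∫ p in simplex, g (a + (p.1 • (b - a) + p.2 • (c - a))) := by
  let coord : Plane ≃ᵐ ℝ × ℝ :=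
    (MeasurableEquiv.toLp 2 (Fin 2 → ℝ)).symm.trans MeasurableEquiv.finTwoArrow
  have h_coord : MeasurePreserving coord volume volume :=
    (volume_preserving_finTwoArrow ℝ).comp
      (EuclideanSpace.volume_preserving_symm_measurableEquiv_toLp (Fin 2))
  have h_image : (fun x => a + planeFrame (b - a) (c - a) x) '' (coord ⁻¹' simplex) =
      convexHull ℝ {a, b, c} := by
    rw [← image_simplex_eq_convexHull, ← image_preimage_eq simplex coord.surjective, image_image,
      preimage_image_eq _ coord.injective]
    rfl
  rw [← h_image, integral_image_eq_integral_abs_det_fderiv_smul volume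
    (coord.measurable isCompact_simplex.isClosed.measurableSet)
    (fun x _ => ((planeFrame _ _).hasFDerivAt.const_add a).hasFDerivWithinAt)
    (fun x _ y _ hxy => planeFrame_injective h (add_left_cancel hxy)),
    ← h_coord.setIntegral_preimage_emb coord.measurableEmbedding, integral_smul, det_planeFrame]
  rfl

theorem sign_mul_abs (x : ℝ) : Real.sign x * |x| = x := by
  obtain hx | rfl | hx := lt_trichotomy x 0
  · rw [Real.sign_of_neg hx, abs_of_neg hx, neg_one_mul, neg_neg]
  · rw [abs_zero, mul_zero]
  · rw [Real.sign_of_pos hx, abs_of_pos hx, one_mul]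

theorem triangle_apply (a b c : Plane) (φ : TestForm 2) :
    triangle a b c φ = det (b - a) (c - a) *
      ∫ p in simplex, coeff φ (a + (p.1 • (b - a) + p.2 • (c - a))) := by
  change Real.sign _ * ∫ x in convexHull ℝ {a, b, c}, coeff φ x = _
  by_cases h : det (b - a) (c - a) = 0
  · rw [h, Real.sign_zero, zero_mul, zero_mul]
  · rw [setIntegral_convexHull_triple h, smul_eq_mul, ← mul_assoc, sign_mul_abs]

theorem boundary_triangle (a b c : Plane) :
    boundary (triangle a b c) = edge a b + edge b c + edge c a := by
  ext φ
  rw [← det_mul_setIntegral_coeff_extDerivTest]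
  exact triangle_apply a b c _

theorem isIntegralCurrent_triangle (a b c : Plane) : IsIntegralCurrent (triangle a b c) := by
  have h_compact : IsCompact (convexHull ℝ ({a, b, c} : Set Plane)) :=
    (Set.toFinite _).isCompact_convexHull ℝ
  have h_meas := h_compact.isClosed.measurableSet
  obtain ⟨m, hm⟩ : ∃ m : ℤ, Real.sign (det (b - a) (c - a)) = m := by
    obtain h | h | h := Real.sign_apply_eq (det (b - a) (c - a))
    exacts [⟨-1, by simp [h]⟩, ⟨0, by simp [h]⟩, ⟨1, by simp [h]⟩]
  have h_cast : ∀ x, (((convexHull ℝ {a, b, c}).indicator (fun _ => m) x : ℤ) : ℝ) =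
      (convexHull ℝ {a, b, c}).indicator (fun _ => (m : ℝ)) x := fun x => by
    by_cases hx : x ∈ convexHull ℝ {a, b, c} <;> simp [hx]
  refine ⟨⟨(convexHull ℝ {a, b, c}).indicator fun _ => m,
    .intro h_compact fun x hx => indicator_of_notMem hx _, ?_, fun φ => ?_⟩, ?_⟩
  · simp only [h_cast]
    rw [integrable_indicator_iff h_meas]
    exact continuousOn_const.integrableOn_compact h_compact
  · change Real.sign _ * ∫ x in convexHull ℝ {a, b, c}, coeff φ x = _
    simp only [h_cast, ← indicator_mul_left]
    rw [integral_indicator h_meas, integral_const_mul, hm]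
  · rw [boundary_triangle]
    refine (mass_add_le _ _).trans_lt (ENNReal.add_lt_top.2 ⟨?_, mass_edge_lt_top c a⟩)
    exact (mass_add_le _ _).trans_lt
      (ENNReal.add_lt_top.2 ⟨mass_edge_lt_top a b, mass_edge_lt_top b c⟩)

theorem isPositiveOn_triangle {K : Set Plane} (hK : Convex ℝ K) {a b c : Plane} (ha : a ∈ K)
    (hb : b ∈ K) (hc : c ∈ K) (h : 0 ≤ det (b - a) (c - a)) :
    IsPositiveOn K (triangle a b c) := fun φ ψ hφψ => by
  have h_subset : convexHull ℝ {a, b, c} ⊆ K :=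
    convexHull_min (by rintro x (rfl | rfl | rfl) <;> assumption) hK
  have h_integrable (η : TestForm 2) : IntegrableOn
      (fun p : ℝ × ℝ => coeff η (a + (p.1 • (b - a) + p.2 • (c - a)))) simplex :=
    ((coeff_continuous η).comp (by fun_prop)).continuousOn.integrableOn_compact isCompact_simplex
  rw [triangle_apply, triangle_apply]
  refine mul_le_mul_of_nonneg_left (setIntegral_mono_on (h_integrable φ) (h_integrable ψ)
    isCompact_simplex.isClosed.measurableSet fun p hp => hφψ _ (h_subset ?_)) h
  rw [← image_simplex_eq_convexHull]
  exact mem_image_of_mem _ hp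

end Triangle

section Separation

variable {d : ℕ} {K L : Set Plane} {T U : Current d}

/-- `T` sees only the values on `K` of a test form, not its derivatives there; for currents of
finite mass and closed `K` this says that the support of `T` lies in `K`. -/
def SupportedIn (K : Set Plane) (T : Current d) : Prop :=
  ∀ φ ψ : TestForm d, (∀ x ∈ K, φ.1 x = ψ.1 x) → T φ = T ψ

theorem SupportedIn.zero (K : Set Plane) : SupportedIn K (0 : Current d) :=
  fun _ _ _ => rfl

theorem SupportedIn.mono (hT : SupportedIn K T) (hKL : K ⊆ L) : SupportedIn L T :=
  fun φ ψ h => hT φ ψ fun x hx => h x (hKL hx)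

theorem SupportedIn.add (hT : SupportedIn K T) (hU : SupportedIn K U) : SupportedIn K (T + U) :=
  fun φ ψ h => congrArg₂ (· + ·) (hT φ ψ h) (hU φ ψ h)

theorem SupportedIn.sub (hT : SupportedIn K T) (hU : SupportedIn K U) : SupportedIn K (T - U) :=
  fun φ ψ h => congrArg₂ (· - ·) (hT φ ψ h) (hU φ ψ h)

theorem SupportedIn.sum {ι : Type*} {s : Finset ι} {T : ι → Current d}
    (hT : ∀ i ∈ s, SupportedIn K (T i)) : SupportedIn K (∑ i ∈ s, T i) :=
  Finset.sum_induction _ _ (fun _ _ => .add) (.zero K) hT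

theorem supportedIn_edge (hK : Convex ℝ K) {a b : Plane} (ha : a ∈ K) (hb : b ∈ K) :
    SupportedIn K (edge a b) := fun φ ψ h => by
  change (∫ t in (0 : ℝ)..1, φ.1 (a + t • (b - a)) fun _ => b - a) =
    ∫ t in (0 : ℝ)..1, ψ.1 (a + t • (b - a)) fun _ => b - a
  apply intervalIntegral.integral_congr
  intro t ht
  rw [uIcc_of_le zero_le_one] at ht
  simp only [h _ (hK.add_smul_sub_mem ha hb ht)]

/-- The product of a smooth function and a test form. -/
noncomputable def smulTestForm (f : Plane → ℝ) (hf : ContDiff ℝ (⊤ : ℕ∞) f) (φ : TestForm d) :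
    TestForm d :=
  ⟨fun x => f x • φ.1 x, hf.smul φ.2.1, φ.2.2.smul_left (f := f)⟩

theorem exists_smooth_zero_one (hK : IsClosed K) (hL : IsClosed L) (hKL : Disjoint K L) :
    ∃ f : Plane → ℝ, ContDiff ℝ (⊤ : ℕ∞) f ∧ (∀ x ∈ K, f x = 0) ∧ (∀ x ∈ L, f x = 1) ∧
      ∀ x, f x ∈ Icc 0 1 := by
  obtain ⟨f, hf_zero, hf_one, hf_mem⟩ :=
    exists_contMDiffMap_zero_one_of_isClosed (n := ⊤) (modelWithCornersSelf ℝ Plane) hK hL hKL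
  exact ⟨f, f.contMDiff.contDiff, hf_zero, hf_one, hf_mem⟩

theorem SupportedIn.exists_testForm_add (hT : SupportedIn K T) (hU : SupportedIn L U)
    (hK : IsClosed K) (hL : IsClosed L) (hKL : Disjoint K L) {φ ψ : TestForm d}
    (hφ : ∀ x, ‖φ.1 x‖ ≤ 1) (hψ : ∀ x, ‖ψ.1 x‖ ≤ 1) :
    ∃ η : TestForm d, (∀ x, ‖η.1 x‖ ≤ 1) ∧ (T + U) η = T φ + U ψ := by
  obtain ⟨f, hf, hfK, hfL, hf_mem⟩ := exists_smooth_zero_one hK hL hKL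
  refine ⟨smulTestForm (fun x => 1 - f x) (contDiff_const.sub hf) φ + smulTestForm f hf ψ,
    fun x => ?_, congrArg₂ (· + ·) (hT _ _ fun x hx => ?_) (hU _ _ fun x hx => ?_)⟩
  · have h_convex := convex_closedBall (0 : Plane [⋀^Fin d]→L[ℝ] ℝ) 1
    exact mem_closedBall_zero_iff.1 <| h_convex (mem_closedBall_zero_iff.2 (hφ x))
      (mem_closedBall_zero_iff.2 (hψ x)) (sub_nonneg.2 (hf_mem x).2) (hf_mem x).1 (by ring)
  · simp [smulTestForm, hfK x hx]
  · simp [smulTestForm, hfL x hx]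

theorem exists_apply_nonneg_ofReal_eq (T : Current d) {φ : TestForm d} (hφ : ∀ x, ‖φ.1 x‖ ≤ 1) :
    ∃ ψ : TestForm d, (∀ x, ‖ψ.1 x‖ ≤ 1) ∧ 0 ≤ T ψ ∧
      ENNReal.ofReal (T φ) = ENNReal.ofReal (T ψ) := by
  obtain h | h := le_total 0 (T φ)
  · exact ⟨φ, hφ, h, rfl⟩
  · exact ⟨0, by simp, by simp, by simp [ENNReal.ofReal_of_nonpos h]⟩

theorem SupportedIn.mass_add_mass_le (hT : SupportedIn K T) (hU : SupportedIn L U)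
    (hK : IsClosed K) (hL : IsClosed L) (hKL : Disjoint K L) :
    mass T + mass U ≤ mass (T + U) := by
  have : Nonempty {φ : TestForm d // ∀ x, ‖φ.1 x‖ ≤ 1} := ⟨0, by simp⟩
  refine ENNReal.iSup_add_iSup_le fun ⟨φ₀, hφ₀⟩ ⟨ψ₀, hψ₀⟩ => ?_
  obtain ⟨φ, hφ, hTφ, hφ_eq⟩ := exists_apply_nonneg_ofReal_eq T hφ₀
  obtain ⟨ψ, hψ, hUψ, hψ_eq⟩ := exists_apply_nonneg_ofReal_eq U hψ₀
  obtain ⟨η, hη, h_add⟩ := hT.exists_testForm_add hU hK hL hKL hφ hψ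
  rw [hφ_eq, hψ_eq, ← ENNReal.ofReal_add hTφ hUψ, ← h_add]
  exact ofReal_apply_le_mass _ η hη

theorem sum_mass_le_mass_sum {ι : Type*} {s : Finset ι} {K : ι → Set Plane}
    {T : ι → Current d} (hK : ∀ i ∈ s, IsClosed (K i)) (h_disjoint : (s : Set ι).PairwiseDisjoint K)
    (hT : ∀ i ∈ s, SupportedIn (K i) (T i)) : ∑ i ∈ s, mass (T i) ≤ mass (∑ i ∈ s, T i) := by
  classical
  induction s using Finset.induction_on with
  | empty => simp
  | insert a s ha ih =>
    rw [Finset.forall_mem_insert] at hK hT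
    rw [Finset.coe_insert, pairwiseDisjoint_insert_of_notMem ha] at h_disjoint
    have h_rest : SupportedIn (⋃ i ∈ s, K i) (∑ i ∈ s, T i) :=
      .sum fun i hi => (hT.2 i hi).mono (subset_biUnion_of_mem (u := K) hi)
    rw [Finset.sum_insert ha, Finset.sum_insert ha]
    exact (add_le_add_right (ih hK.2 h_disjoint.1 hT.2) _).trans <|
      hT.1.mass_add_mass_le h_rest hK.1 (isClosed_biUnion_finset hK.2)
        (disjoint_iUnion₂_right.2 h_disjoint.2)

end Separation

section Perturbation

theorem det_sub_sub_left (p q x : Plane) : det (x - p) (q - p) = det (x - q) (q - p) := by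
  simp only [det, PiLp.sub_apply]
  ring

theorem det_sub_sub_right (p q x : Plane) : det (q - x) (p - x) = det (x - p) (q - p) := by
  simp only [det, PiLp.sub_apply]
  ring

variable {n : ℕ} {v : Fin (n + 1) → Plane} {i : Fin (n + 1)} {x : Plane}

theorem isIntegralCurrent_sweptRegion (v : Fin (n + 1) → Plane) (i : Fin (n + 1)) (x : Plane) :
    IsIntegralCurrent (sweptRegion v i x) := by
  refine .sum fun j _ => .add ?_ ?_ <;> split_ifs
  exacts [isIntegralCurrent_triangle _ _ _, .zero, isIntegralCurrent_triangle _ _ _, .zero]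

theorem isPositiveOn_sweptRegion {δ : ℝ} (hx : x ∈ positiveCone δ v i) {K : Set Plane}
    (hK : Convex ℝ K) (hv : ∀ j, v j ∈ K) (hxK : x ∈ K) : IsPositiveOn K (sweptRegion v i x) := by
  refine .sum fun j _ => .add ?_ ?_ <;> split_ifs with hj
  · refine isPositiveOn_triangle hK (hv _) hxK (hv _) ?_
    rw [det_sub_sub_left, ← hj]
    exact hj ▸ (hx.2 j (.inr hj)).le
  · exact .zero K
  · refine isPositiveOn_triangle hK hxK (hv _) (hv _) ?_
    rw [det_sub_sub_right, ← hj]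
    exact hj ▸ (hx.2 j (.inl hj)).le
  · exact .zero K

/-- The part of the difference of the new and the old curve that the boundary of the swept region
misses when the node `i` is moved from `y` to `x`. It is carried by the segment between `x` and
`y` and is present at the two ends of the curve only. -/
noncomputable def endpointGap (i : Fin (n + 1)) (x y : Plane) : Current 1 :=
  (if 0 = i then edge x y else 0) - (if Fin.last n = i then edge x y else 0)

theorem endpointGap_eq_zero (h_zero : i ≠ 0) (h_last : i ≠ Fin.last n) (x y : Plane) :
    endpointGap i x y = 0 := by
  rw [endpointGap, if_neg h_zero.symm, if_neg h_last.symm, sub_zero]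

theorem endpointGap_eq_zero_of_mem_Icc {k₀ k : Fin (n + 1)} (h_zero : k₀ ≠ 0)
    (h_last : k ≠ Fin.last n) (hi : i ∈ Finset.Icc k₀ k) (x y : Plane) :
    endpointGap i x y = 0 := by
  obtain ⟨hi₀, hik⟩ := Finset.mem_Icc.1 hi
  exact endpointGap_eq_zero ((Fin.pos_iff_ne_zero.2 h_zero).trans_le hi₀).ne'
    (hik.trans_lt (Fin.lt_last_iff_ne_last.2 h_last)).ne x y

theorem supportedIn_endpointGap (i : Fin (n + 1)) {K : Set Plane} (hK : Convex ℝ K) {x y : Plane}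
    (hx : x ∈ K) (hy : y ∈ K) : SupportedIn K (endpointGap i x y) := by
  refine .sub ?_ ?_ <;> split_ifs
  exacts [supportedIn_edge hK hx hy, .zero K, supportedIn_edge hK hx hy, .zero K]

theorem edge_update_sub_sub_boundary (v : Fin (n + 1) → Plane) (i : Fin (n + 1)) (x : Plane)
    (j : Fin n) :
    edge (Function.update v i x j.castSucc) (Function.update v i x j.succ) -
        edge (v j.castSucc) (v j.succ) -
        boundary ((if j.succ = i then triangle (v j.castSucc) x (v i) else 0) +
          (if j.castSucc = i then triangle x (v j.succ) (v i) else 0)) =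
      (if j.castSucc = i then edge x (v i) else 0) - (if j.succ = i then edge x (v i) else 0) := by
  have h_ne : j.castSucc ≠ j.succ := Fin.castSucc_lt_succ.ne
  by_cases h_succ : j.succ = i
  · subst h_succ
    simp only [h_ne, if_true, if_false, add_zero, boundary_triangle, Function.update_of_ne h_ne,
      Function.update_self, edge_swap (v j.castSucc) (v j.succ)]
    abel
  by_cases h_castSucc : j.castSucc = i
  · subst h_castSucc
    simp only [h_succ, if_true, if_false, zero_add, boundary_triangle,
      Function.update_of_ne h_succ, Function.update_self, edge_swap x (v j.castSucc),
      edge_swap (v j.castSucc) (v j.succ)]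
    abel
  · simp only [h_succ, h_castSucc, if_false, add_zero, boundary_zero, Function.update_of_ne h_succ,
      Function.update_of_ne h_castSucc, sub_self]

theorem pwl_update_sub_sub_boundary (v : Fin (n + 1) → Plane) (i : Fin (n + 1)) (x : Plane) :
    pwl (Function.update v i x) - pwl v - boundary (sweptRegion v i x) =
      endpointGap i x (v i) := by
  let f : Fin (n + 1) → Current 1 := fun j => if j = i then edge x (v i) else 0
  have h_telescope : ∑ j : Fin n, (f j.castSucc - f j.succ) = f 0 - f (Fin.last n) := by
    rw [Finset.sum_sub_distrib, sub_eq_sub_iff_add_eq_add, ← Fin.sum_univ_castSucc,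
      ← Fin.sum_univ_succ]
  rw [endpointGap, ← h_telescope, pwl, pwl, sweptRegion, boundary_sum, ← Finset.sum_sub_distrib,
    ← Finset.sum_sub_distrib]
  exact Finset.sum_congr rfl fun j _ => edge_update_sub_sub_boundary v i x j

end Perturbation

section Sequence

theorem exists_convex_isCalibration {ι : Type*} [Finite ι] (v : ι → Plane) (M : ℝ) :
    ∃ K : Set Plane, Convex ℝ K ∧ (∀ i, ball (v i) M ⊆ K) ∧
      ∃ ω : TestForm 1, IsCalibration K (extDerivTest 1 ω) :=
  ⟨convexHull ℝ (thickening M (range v)), convex_convexHull ℝ _,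
    fun i => (ball_subset_thickening (mem_range_self i) M).trans (subset_convexHull ℝ _),
    exists_isCalibration_extDerivTest
      (isBounded_convexHull.2 (finite_range v).isBounded.thickening)⟩

theorem exists_pos_mul_norm_le_one {d : ℕ} (φ : TestForm d) :
    ∃ c : ℝ, 0 < c ∧ ∀ x, c * ‖φ.1 x‖ ≤ 1 := by
  obtain ⟨C, hC⟩ := φ.2.2.exists_bound_of_continuous φ.2.1.continuous
  have hC_pos : 0 < C + 1 := by linarith [norm_nonneg (φ.1 0), hC 0]
  refine ⟨(C + 1)⁻¹, inv_pos.2 hC_pos, fun x => ?_⟩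
  rw [inv_mul_le_one₀ hC_pos]
  linarith [hC x]

/-- A sequence of perturbations of the adjacent nodes `k₀, …, k` as in `IsPositiveSequence`, except
that the new nodes are only asked to lie in the positive cones: the new edges may meet the curve. -/
def IsConeSequence {n : ℕ} (δ : ℝ) (k₀ k : Fin (n + 1)) (v : Fin (n + 1) → Plane)
    (T : ℕ → Fin (n + 1) → Plane) : Prop :=
  T k₀ = v ∧ ∀ i : Fin (n + 1), k₀ ≤ i → i ≤ k → T (i + 1) i ∈ positiveCone δ (T i) i ∧
    T (i + 1) = Function.update (T i) i (T (i + 1) i)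

variable {n : ℕ} {δ : ℝ} {k₀ k : Fin (n + 1)} {v : Fin (n + 1) → Plane}
  {T : ℕ → Fin (n + 1) → Plane}

theorem IsPositiveSequence.isConeSequence (h : IsPositiveSequence δ k₀ k v T) :
    IsConeSequence δ k₀ k v T := by
  refine ⟨h.1, fun i hi hik => ?_⟩
  obtain ⟨x, hx, h_update⟩ := h.2 i hi hik
  have hx_eq : T (i + 1) i = x := by rw [h_update, Function.update_self]
  rw [hx_eq]
  exact ⟨hx.1, h_update⟩

namespace IsConeSequence

theorem pos (h : IsConeSequence δ k₀ k v T) (hk : k₀ ≤ k) : 0 < δ :=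
  pos_of_mem_ball (h.2 k₀ le_rfl hk).1.1

theorem apply_of_le (h : IsConeSequence δ k₀ k v T) {m : ℕ} (hm : k₀ ≤ m) (hmk : m ≤ k + 1)
    {j : Fin (n + 1)} (hj : m ≤ j) : T m j = v j := by
  induction m, hm using Nat.le_induction with
  | base => rw [h.1]
  | succ m hm ih =>
    have h_update := (h.2 ⟨m, by omega⟩ hm (Fin.le_def.2 (by simp only; omega))).2
    simp only at h_update
    rw [h_update, Function.update_of_ne (Fin.ne_of_gt hj), ih (by omega) (by omega)]

theorem apply_mem_ball (h : IsConeSequence δ k₀ k v T) (hδ : 0 < δ) {m : ℕ} (hm : k₀ ≤ m)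
    (hmk : m ≤ k + 1) (j : Fin (n + 1)) : T m j ∈ ball (v j) δ := by
  induction m, hm using Nat.le_induction with
  | base =>
    rw [h.1]
    exact mem_ball_self hδ
  | succ m hm ih =>
    obtain ⟨h_cone, h_update⟩ := h.2 ⟨m, by omega⟩ hm (Fin.le_def.2 (by simp only; omega))
    simp only at h_cone h_update
    obtain rfl | hj := eq_or_ne j ⟨m, by omega⟩
    · rw [← h.apply_of_le hm (by omega) le_rfl]
      exact h_cone.1
    · rw [h_update, Function.update_of_ne hj]
      exact ih (by omega)

theorem isPositiveOn_sweptRegion (h : IsConeSequence δ k₀ k v T) {K : Set Plane}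
    (hK : Convex ℝ K) (hv : ∀ j, ball (v j) δ ⊆ K) {i : Fin (n + 1)} (hi : i ∈ Finset.Icc k₀ k) :
    IsPositiveOn K (sweptRegion (T i) i (T (i + 1) i)) := by
  obtain ⟨hi₀, hik⟩ := Finset.mem_Icc.1 hi
  have hδ := h.pos (hi₀.trans hik)
  exact PlaneCurrent.isPositiveOn_sweptRegion (h.2 i hi₀ hik).1 hK
    (fun j => hv j (h.apply_mem_ball hδ hi₀ (Nat.le_succ_of_le hik) j))
    (hv i (h.apply_mem_ball hδ (Nat.le_succ_of_le hi₀) (Nat.succ_le_succ hik) i))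

theorem sub_sub_boundary_sweptRegion (h : IsConeSequence δ k₀ k v T) {i : Fin (n + 1)}
    (hi : i ∈ Finset.Icc k₀ k) :
    pwl (T (i + 1)) - pwl (T i) - boundary (sweptRegion (T i) i (T (i + 1) i)) =
      endpointGap i (T (i + 1) i) (T i i) := by
  obtain ⟨hi₀, hik⟩ := Finset.mem_Icc.1 hi
  rw [← pwl_update_sub_sub_boundary, ← (h.2 i hi₀ hik).2]

theorem isAdditive (h : IsConeSequence δ k₀ k v T) (hk : k₀ ≤ k)
    (h_gap : ∑ i ∈ Finset.Icc k₀ k, mass (endpointGap i (T (i + 1) i) (T i i)) ≤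
      mass (∑ i ∈ Finset.Icc k₀ k, endpointGap i (T (i + 1) i) (T i i)))
    {lam : ℝ} (h_filled : FilledVoids lam k₀ k T) : IsAdditive lam k₀ k T := by
  obtain ⟨K, hK, hv, ω, hω⟩ := exists_convex_isCalibration v δ
  have h_telescope := Fin.sum_Icc_sub hk fun m => pwl (T m)
  simp only [Fin.val_succ, Fin.val_castSucc] at h_telescope
  have h_optimal := h_filled.2.le
  rw [IsAdditive, ← h_telescope]
  rw [← h_telescope] at h_optimal
  refine flatNorm_sum_eq (fun i _ => isIntegralCurrent_sweptRegion (T i) i (T (i + 1) i)) ?_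
    (hω.sum_mass_eq fun i hi => h.isPositiveOn_sweptRegion hK hv hi).le h_optimal
  rwa [Finset.sum_congr rfl fun i hi => congrArg mass (h.sub_sub_boundary_sweptRegion hi),
    Finset.sum_congr rfl fun i hi => h.sub_sub_boundary_sweptRegion hi]

theorem sum_mass_endpointGap_le (h : IsConeSequence δ k₀ k v T)
    (h_sep : δ + δ < dist (v 0) (v (Fin.last n))) :
    ∑ i ∈ Finset.Icc k₀ k, mass (endpointGap i (T (i + 1) i) (T i i)) ≤
      mass (∑ i ∈ Finset.Icc k₀ k, endpointGap i (T (i + 1) i) (T i i)) := by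
  let K : Fin (n + 1) → Set Plane := fun i =>
    if i = 0 ∨ i = Fin.last n then closedBall (v i) δ else ∅
  have hK_closed : ∀ i, IsClosed (K i) := fun i => by
    dsimp only [K]
    split_ifs
    exacts [isClosed_closedBall, isClosed_empty]
  have h_balls := closedBall_disjoint_closedBall h_sep
  have hK_disjoint : ∀ i j, i ≠ j → Disjoint (K i) (K j) := fun i j hij => by
    dsimp only [K]
    split_ifs with hi hj
    · obtain rfl | rfl := hi <;> obtain rfl | rfl := hj
      exacts [absurd rfl hij, h_balls, h_balls.symm, absurd rfl hij]
    exacts [disjoint_empty _, empty_disjoint _, empty_disjoint _]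
  refine sum_mass_le_mass_sum (fun i _ => hK_closed i) (fun i _ j _ => hK_disjoint i j)
    fun i hi => ?_
  obtain ⟨hi₀, hik⟩ := Finset.mem_Icc.1 hi
  by_cases h_end : i = 0 ∨ i = Fin.last n
  · have hδ := h.pos (hi₀.trans hik)
    dsimp only [K]
    rw [if_pos h_end]
    exact supportedIn_endpointGap i (convex_closedBall _ _)
      (ball_subset_closedBall
        (h.apply_mem_ball hδ (Nat.le_succ_of_le hi₀) (Nat.succ_le_succ hik) i))
      (ball_subset_closedBall (h.apply_mem_ball hδ hi₀ (Nat.le_succ_of_le hik) i))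
  · rw [not_or] at h_end
    rw [endpointGap_eq_zero h_end.1 h_end.2]
    exact .zero _

theorem boundary_void (h : IsConeSequence δ k₀ k v T) (hk : k₀ ≤ k) (h_zero : k₀ ≠ 0)
    (h_last : k ≠ Fin.last n) : boundary (void k₀ k T) = pwl (T (k + 1)) - pwl (T k₀) := by
  have h_telescope := Fin.sum_Icc_sub hk fun m => pwl (T m)
  simp only [Fin.val_succ, Fin.val_castSucc] at h_telescope
  rw [← h_telescope, void, boundary_sum]
  refine Finset.sum_congr rfl fun i hi => (sub_eq_zero.1 ?_).symm
  rw [h.sub_sub_boundary_sweptRegion hi, endpointGap_eq_zero_of_mem_Icc h_zero h_last hi]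

theorem filledVoids (h : IsConeSequence δ k₀ k v T) (hk : k₀ ≤ k) (h_zero : k₀ ≠ 0)
    (h_last : k ≠ Fin.last n) {K : Set Plane} (hK : Convex ℝ K) (hv : ∀ j, ball (v j) δ ⊆ K)
    {ω : TestForm 1} (hω : IsCalibration K (extDerivTest 1 ω)) {lam : ℝ} (hlam : 0 ≤ lam)
    (hlamω : ∀ x, lam * ‖ω.1 x‖ ≤ 1) : FilledVoids lam k₀ k T := by
  have h_integral : IsIntegralCurrent (void k₀ k T) :=
    .sum fun i _ => isIntegralCurrent_sweptRegion (T i) i (T (i + 1) i)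
  have h_positive : IsPositiveOn K (void k₀ k T) :=
    .sum fun i hi => h.isPositiveOn_sweptRegion hK hv hi
  refine ⟨h_integral, (le_iInf fun U => ?_).antisymm (flatNorm_le_flatCost _ _ h_integral)⟩
  rw [← h.boundary_void hk h_zero h_last]
  exact hω.flatCost_le h_positive hlam hlamω U.1

end IsConeSequence

end Sequence

end PlaneCurrent

theorem mainTheorem6_general {n : ℕ} (v : Fin (n + 1) → Plane) :
    (v 0 ≠ v (Fin.last n) → ∃ M₀ : ℝ, 0 < M₀ ∧ ∀ lam : ℝ, 0 < lam → ∀ δ : ℝ, δ < M₀ →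
      ∀ k₀ k : Fin (n + 1), k₀ ≤ k → ∀ T : ℕ → Fin (n + 1) → Plane,
        IsConeSequence δ k₀ k v T → FilledVoids lam k₀ k T → IsAdditive lam k₀ k T) ∧
    (∀ M : ℝ, ∃ lam₀ : ℝ, 0 < lam₀ ∧ ∀ lam : ℝ, 0 < lam → lam ≤ lam₀ → ∀ δ : ℝ, δ ≤ M →
      ∀ k₀ k : Fin (n + 1), k₀ ≤ k → k₀ ≠ 0 → k ≠ Fin.last n →
        ∀ T : ℕ → Fin (n + 1) → Plane, IsConeSequence δ k₀ k v T →
          FilledVoids lam k₀ k T ∧ IsAdditive lam k₀ k T) := by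
  refine ⟨fun h_ne => ⟨dist (v 0) (v (Fin.last n)) / 2, half_pos (dist_pos.2 h_ne),
    fun lam _ δ hδ k₀ k hk T hT => hT.isAdditive hk (hT.sum_mass_endpointGap_le ?_)⟩, fun M => ?_⟩
  · linarith
  · obtain ⟨K, hK, hv, ω, hω⟩ := exists_convex_isCalibration v M
    obtain ⟨lam₀, hlam₀, h_norm⟩ := exists_pos_mul_norm_le_one ω
    refine ⟨lam₀, hlam₀, fun lam hlam hle δ hδ k₀ k hk h_zero h_last T hT => ?_⟩
    have h_filled : FilledVoids lam k₀ k T := hT.filledVoids hk h_zero h_last hK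
      (fun j => (ball_subset_ball hδ).trans (hv j)) hω hlam.le
      fun x => (mul_le_mul_of_nonneg_right hle (norm_nonneg _)).trans (h_norm x)
    refine ⟨h_filled, hT.isAdditive hk ?_ h_filled⟩
    rw [Finset.sum_eq_zero fun i hi => by
      rw [endpointGap_eq_zero_of_mem_Icc h_zero h_last hi, mass_zero]]
    exact zero_le

theorem mainTheorem6 (n : ℕ) (hn : 2 ≤ n) (v : Fin (n + 1) → Plane) (hv : IsSimple v) :
    (∃ M₀ : ℝ, 0 < M₀ ∧ ∀ lam : ℝ, 0 < lam → ∀ δ : ℝ, 0 < δ → δ < M₀ →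
      ∀ k₀ k : Fin (n + 1), k₀ < k → ∀ T : ℕ → Fin (n + 1) → Plane,
        IsPositiveSequence δ k₀ k v T → FilledVoids lam k₀ k T → IsAdditive lam k₀ k T) ∧
    (∃ lam₀ : ℝ, 0 < lam₀ ∧ ∀ lam : ℝ, 0 < lam → lam < lam₀ →
      ∃ M : ℝ, 0 < M ∧ ∀ δ : ℝ, 0 < δ → δ < M →
        ∀ k₀ k : Fin (n + 1), k₀ < k → k₀ ≠ 0 → k ≠ Fin.last n →
          ∀ T : ℕ → Fin (n + 1) → Plane, IsPositiveSequence δ k₀ k v T →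
            FilledVoids lam k₀ k T ∧ IsAdditive lam k₀ k T) := by
  have h_ne : v 0 ≠ v (Fin.last n) := hv.1.ne (Fin.ne_of_lt (Fin.lt_def.2 (by simp; omega)))
  obtain ⟨⟨M₀, hM₀, h_additive⟩, lam₀, hlam₀, h_filled⟩ :=
    (mainTheorem6_general v).imp (· h_ne) (· 1)
  exact ⟨⟨M₀, hM₀, fun lam hlam δ _ hδ k₀ k hk T hT =>
      h_additive lam hlam δ hδ k₀ k hk.le T hT.isConeSequence⟩,
    lam₀, hlam₀, fun lam hlam hlt => ⟨1, one_pos, fun δ _ hδ k₀ k hk h_zero h_last T hT =>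
      h_filled lam hlam hlt.le δ hδ.le k₀ k hk.le h_zero h_last T hT.isConeSequence⟩⟩
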